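/- Let $0\le m\le n$ be integers. Let $G(n,m)$ be the Grassmannian of $m$-dimensional linear subspaces of $\mathbb{R}^n$, let $\gamma_{n,m}$ be its $O(n)$-invariant Borel probability measure, and for $V\in G(n,m)$ let $P_V:\mathbb{R}^n\to V$ be the orthogonal projection and $\mathcal H^m$ the $m$-dimensional Hausdorff measure on $V$, normalized to be Lebesgue measure. For Borel measures $\mu,\nu$ on $\mathbb{R}^n$ put $$I_m(\mu,\nu)=\iint |x-y|^{-m}\,d\mu(x)\,d\nu(y)\in[0,\infty],\qquad I_m(\mu)=I_m(\mu,\mu).$$ There is a constant $0<c<\infty$, depending only on $n$ and $m$, such that the following holds. Let $\mu,\nu$ be Borel measures on $\mathbb{R}^n$ with compact supports, with $0<\mu(\mathbb{R}^n)<\infty$, $0<\nu(\mathbb{R}^n)<\infty$, and with $I_m(\mu)<\infty$ and $I_m(\nu)<\infty$. Then for $\gamma_{n,m}$-almost every $V$ the image measures $P_{V\sharp}\mu$ and $P_{V\sharp}\nu$ are absolutely continuous with respect to $\mathcal H^m$ on $V$; denoting their Radon–Nikodym derivatives by the same symbols, the function $V\mapsto\int_V P_{V\sharp}\mu(v)\,P_{V\sharp}\nu(v)\,d\mathcal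 H^m(v)$ is $\gamma_{n,m}$-measurable, and $$0<\int_{G(n,m)}\int_V P_{V\sharp}\mu(v)\,P_{V\sharp}\nu(v)\,d\mathcal H^m(v)\,d\gamma_{n,m}(V)=c\,I_m(\mu,\nu)<\infty .$$ Moreover, $$\gamma_{n,m}\big(\{V\in G(n,m):\mathcal H^m(P_V(\operatorname{spt}\mu)\cap P_V(\operatorname{spt}\nu))>0\}\big)>0 .$$ -/

import Mathlib

open MeasureTheory Topology
open scoped ENNReal

namespace IntProj

/-- `ℝⁿ` with the Euclidean norm. -/
abbrev E (n : ℕ) : Type := EuclideanSpace ℝ (Fin n)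

/-- The Grassmannian `G(n, m)` of `m`-dimensional linear subspaces of `ℝⁿ`. -/
def Gr (n m : ℕ) : Type := {V : Submodule ℝ (E n) // Module.finrank ℝ V = m}

/-- The topology of `G(n, m)`, given by the metric `d(V, W) = ‖P_V - P_W‖` (operator norm). -/
noncomputable instance (n m : ℕ) : TopologicalSpace (Gr n m) :=
  TopologicalSpace.induced (fun V : Gr n m => V.1.starProjection) inferInstance

/-- `G(n, m)` carries its Borel `σ`-algebra. -/
noncomputable instance (n m : ℕ) : MeasurableSpace (Gr n m) := borel (Gr n m)

instance (n m : ℕ) : BorelSpace (Gr n m) := ⟨rfl⟩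

/-- The orthogonal group `O(n)`: the operators `g` on `ℝⁿ` with `g* g = g g* = 1`, with the
topology of the operator norm. -/
abbrev O (n : ℕ) : Type := unitary (E n →L[ℝ] E n)

instance (n : ℕ) : ContinuousStar (E n →L[ℝ] E n) :=
  ⟨(ContinuousLinearMap.adjoint (𝕜 := ℝ) (E := E n) (F := E n)).continuous⟩

instance (n : ℕ) : CompactSpace (O n) := by
  refine isCompact_iff_compactSpace.mp ?_
  have hp : ProperSpace (E n →L[ℝ] E n) := FiniteDimensional.proper ℝ _
  refine Metric.isCompact_of_isClosed_isBounded isClosed_unitary ?_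
  refine (Metric.isBounded_closedBall (x := (0 : E n →L[ℝ] E n)) (r := 1)).subset ?_
  intro g hg
  rw [mem_closedBall_zero_iff]
  refine ContinuousLinearMap.opNorm_le_bound _ zero_le_one fun x => ?_
  rw [one_mul]
  exact ((Unitary.linearIsometryEquiv ⟨g, hg⟩).norm_map x).le

/-- The Haar probability measure on `O(n)`. -/
noncomputable def haarO (n : ℕ) : Measure (O n) := Measure.haarMeasure ⊤

instance (n : ℕ) : IsProbabilityMeasure (haarO n) :=
  ⟨Measure.haarMeasure_self (K₀ := (⊤ : TopologicalSpace.PositiveCompacts (O n)))⟩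

/-- The action of `O(n)` on `G(n, m)`: the subspace `g V`. -/
noncomputable def rot {n m : ℕ} (g : O n) (V : Gr n m) : Gr n m :=
  ⟨V.1.map (Unitary.linearIsometryEquiv g).toLinearEquiv.toLinearMap,
    (LinearEquiv.finrank_map_eq _ _).trans V.2⟩

theorem starProjection_rot {n m : ℕ} (g : O n) (V : Gr n m) :
    (rot g V).1.starProjection
      = (g : E n →L[ℝ] E n) * V.1.starProjection * star (g : E n →L[ℝ] E n) := by
  ext1 x
  exact Submodule.starProjection_map_apply (Unitary.linearIsometryEquiv g) V.1 x

theorem continuous_rot {n m : ℕ} (V : Gr n m) : Continuous fun g : O n => rot g V := by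
  rw [continuous_induced_rng]
  simp only [Function.comp_def, starProjection_rot]
  fun_prop

/-- The coordinate plane spanned by the first `m` standard basis vectors of `ℝⁿ`. -/
noncomputable def coordPlane {n m : ℕ} (h : m ≤ n) : Gr n m :=
  ⟨Submodule.span ℝ (Set.range fun i : Fin m => EuclideanSpace.basisFun (Fin n) ℝ (Fin.castLE h i)),
    by
      exact (finrank_span_eq_card
        ((EuclideanSpace.basisFun (Fin n) ℝ).orthonormal.linearIndependent.comp
          _ (Fin.castLE_injective h))).trans (Fintype.card_fin m)⟩

/-- The Haar measure `γ_{n,m}` on `G(n, m)`: the `O(n)`-invariant Borel probability measure, that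
is, the distribution of `g V₀` for `g` Haar distributed on `O(n)` and `V₀` a fixed `m`-plane. -/
noncomputable def grMeasure {n m : ℕ} (h : m ≤ n) : Measure (Gr n m) :=
  (haarO n).map fun g => rot g (coordPlane h)

instance {n m : ℕ} (h : m ≤ n) : IsProbabilityMeasure (grMeasure h) :=
  Measure.isProbabilityMeasure_map (continuous_rot _).measurable.aemeasurable

/-- The class `𝓜(A)` of Borel measures with `0 < μ(A) < ∞` and compact support contained in `A`. -/
def MemM {n : ℕ} (A : Set (E n)) (μ : Measure (E n)) : Prop :=
  0 < μ A ∧ μ A < ∞ ∧ IsCompact μ.support ∧ μ.support ⊆ A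

/-- The mutual energy `I_s(μ, ν) = ∬ |x - y|^{-s} dμ(x) dν(y)` with values in `[0, ∞]`; for `s > 0`
the kernel is `∞` on the diagonal. -/
noncomputable def mutualEnergy {n : ℕ} (s : ℝ) (μ ν : Measure (E n)) : ℝ≥0∞ :=
  ∫⁻ y, ∫⁻ x, edist x y ^ (-s) ∂μ ∂ν

/-- The energy `I_s(μ) = I_s(μ, μ)`. -/
noncomputable def energy {n : ℕ} (s : ℝ) (μ : Measure (E n)) : ℝ≥0∞ := mutualEnergy s μ μ

/-- The orthogonal projection `P_V : ℝⁿ → V`. -/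
noncomputable def proj {n m : ℕ} (V : Gr n m) : E n →L[ℝ] V.1 := V.1.orthogonalProjectionOnto

/-- The image measure `P_{V♯} μ` on `V`. -/
noncomputable def projMeasure {n m : ℕ} (V : Gr n m) (μ : Measure (E n)) : Measure V.1 :=
  μ.map (proj V)

/-- The `m`-dimensional Hausdorff measure on the `m`-plane `V`, normalized to be Lebesgue measure. -/
noncomputable def hausV {n m : ℕ} (V : Gr n m) : Measure V.1 :=
  Measure.euclideanHausdorffMeasure m

/-- The Radon–Nikodym derivative of `P_{V♯} μ` with respect to the Hausdorff measure on `V`. -/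
noncomputable def projDensity {n m : ℕ} (V : Gr n m) (μ : Measure (E n)) : V.1 → ℝ≥0∞ :=
  (projMeasure V μ).rnDeriv (hausV V)

end IntProj

namespace IntProj

open Filter Metric

/-! The proof establishes a quadratic identity and polarizes it: the integral over planes of the
squared `L²` norm of the density of `P_{V♯}μ` equals `c * I_m(μ)` whenever `I_m(μ)` is finite.

On one plane, the squared norm is the limit of the ball energies `∫ α(B(v,δ)) / λ(B(v,δ)) dα(v)`.
They never exceed it (Fubini, translation invariance, `2ab ≤ a² + b²`), and Fatou with Besicovitch
differentiation gives the lower bound, including the value `∞` when `α` is not absolutely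
continuous. Integrated over planes, a ball energy becomes a double integral of the kernel `γ{V :
|P_V z| ≤ δ}`, divided by the volume of an `m`-ball of radius `δ`.

The asymptotics of this kernel are not computed pointwise. The radius is averaged instead, `δ = ε /
|x|` with `x` weighted by `1 - |x|` on the unit ball. Rotation invariance lets `x` and `z` exchange
roles, and a linear change of variables then gives exactly `|z|^{-m}` times a bounded function of `ε
/ |z|` that converges as `ε → 0` (`averagedKernel_radiusLaw`). Dominated convergence yields the
quadratic identity (`exists_grEnergy_eq`).

Polarization needs `I_m(μ,ν) < ∞`, which follows from the cross-term bound on ball energies and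
Fatou. Comparing the expansions for `μ + ν` gives the mixed identity. Its right side is positive
because the Riesz kernel never vanishes, and a product of densities can have positive integral only
if the projected supports meet in positive measure.

If `m = n > 0`, the constant is `0`, so a nonzero measure of finite energy would have zero projected
energy, which is impossible; the claim is vacuous. -/

theorem two_mul_mul_le_sq_add_sq (a b : ℝ≥0∞) : 2 * (a * b) ≤ a ^ 2 + b ^ 2 := by
  rcases eq_or_ne a ∞ with rfl | ha
  · simp
  rcases eq_or_ne b ∞ with rfl | hb
  · simp
  lift a to NNReal using ha
  lift b to NNReal using hb
  norm_cast
  rw [← NNReal.coe_le_coe]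
  push_cast
  nlinarith [sq_nonneg ((a : ℝ) - b)]

/-! ### Squared `L²` norms of densities. -/

section Density

open Classical in
/-- The squared `L²` norm of the density of `α` with respect to `lam`, infinite if `α` is not
absolutely continuous. -/
noncomputable def densityEnergy {X : Type*} [MeasurableSpace X]
    (lam α : Measure X) : ℝ≥0∞ :=
  if α ≪ lam then ∫⁻ v, α.rnDeriv lam v ^ 2 ∂lam else ∞

theorem absolutelyContinuous_of_densityEnergy_ne_top {X : Type*} [MeasurableSpace X]
    {lam α : Measure X} (h : densityEnergy lam α ≠ ∞) : α ≪ lam := by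
  by_contra hα
  simp [densityEnergy, hα] at h

theorem densityEnergy_of_absolutelyContinuous {X : Type*} [MeasurableSpace X]
    {lam α : Measure X} (h : α ≪ lam) :
    densityEnergy lam α = ∫⁻ v, α.rnDeriv lam v ^ 2 ∂lam := by
  simp [densityEnergy, h]

theorem eq_zero_of_densityEnergy_eq_zero {X : Type*} [MeasurableSpace X]
    {lam α : Measure X} [SigmaFinite lam] [IsFiniteMeasure α]
    (h : densityEnergy lam α = 0) : α = 0 := by
  have hα := absolutelyContinuous_of_densityEnergy_ne_top (h ▸ ENNReal.zero_ne_top)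
  rw [densityEnergy_of_absolutelyContinuous hα,
    lintegral_eq_zero_iff ((Measure.measurable_rnDeriv _ _).pow_const 2)] at h
  rw [← Measure.withDensity_rnDeriv_eq α lam hα]
  refine (withDensity_congr_ae (g := 0) ?_).trans (withDensity_zero)
  filter_upwards [h] with v hv
  simpa using hv

/-- The square of a sum of densities; this is the source of the polarization. -/
theorem densityEnergy_add {X : Type*} [MeasurableSpace X]
    {lam α β : Measure X} [SigmaFinite lam] [IsFiniteMeasure α] [IsFiniteMeasure β]
    (hα : α ≪ lam) (hβ : β ≪ lam) :
    densityEnergy lam (α + β) = densityEnergy lam α + densityEnergy lam β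
      + 2 * ∫⁻ v, α.rnDeriv lam v * β.rnDeriv lam v ∂lam := by
  have hαβ : α + β ≪ lam := hα.add_left hβ
  have hfm : Measurable (α.rnDeriv lam) := Measure.measurable_rnDeriv _ _
  have hgm : Measurable (β.rnDeriv lam) := Measure.measurable_rnDeriv _ _
  rw [densityEnergy_of_absolutelyContinuous hα, densityEnergy_of_absolutelyContinuous hβ,
    densityEnergy_of_absolutelyContinuous hαβ, 
    ← lintegral_const_mul _ (f := fun v => α.rnDeriv lam v * β.rnDeriv lam v) (hfm.mul hgm),
    ← lintegral_add_left (by fun_prop), ← lintegral_add_left (by fun_prop)]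
  refine lintegral_congr_ae ?_
  filter_upwards [Measure.rnDeriv_add' α β lam] with v hv
  rw [hv, Pi.add_apply]
  ring

end Density

/-! ### Approximation of the squared norm by ball averages on a single space. -/

section Pointwise

variable {W : Type*} [NormedAddCommGroup W] [InnerProductSpace ℝ W] [FiniteDimensional ℝ W]
  [MeasurableSpace W] [BorelSpace W]

theorem measurable_measure_closedBall (α : Measure W) [SFinite α] (δ : ℝ) :
    Measurable fun v => α (closedBall v δ) := by
  have h : MeasurableSet {p : W × W | dist p.2 p.1 ≤ δ} :=
    (isClosed_le (by fun_prop) continuous_const).measurableSet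
  exact measurable_measure_prodMk_left h

/-- The integral over `β` of the mean density of `α` in balls of radius `δ`. -/
noncomputable def ballEnergy (lam : Measure W) (δ : ℝ) (α β : Measure W) : ℝ≥0∞ :=
  ∫⁻ v, α (closedBall v δ) / lam (closedBall v δ) ∂β

variable (lam : Measure W) [lam.IsAddHaarMeasure]

/-- With densities `f`, `g`, the ball energy is the mean over `|u| ≤ δ` of `∫ f(v + u) g(v) dv`.
Apply `2ab ≤ a² + b²` and translation invariance for each `u`. Without absolute continuity the right
side is `∞`. -/
theorem two_mul_ballEnergy_le (α β : Measure W) [IsFiniteMeasure α] [IsFiniteMeasure β]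
    (δ : ℝ) :
    2 * ballEnergy lam δ α β ≤ densityEnergy lam α + densityEnergy lam β := by
  by_cases hα : α ≪ lam
  swap
  · simp [densityEnergy, hα]
  by_cases hβ : β ≪ lam
  swap
  · simp [densityEnergy, hβ]
  simp only [densityEnergy, hα, hβ, if_true]
  set f := α.rnDeriv lam with hf
  set g := β.rnDeriv lam
  have hfm : Measurable f := Measure.measurable_rnDeriv _ _
  have hgm : Measurable g := Measure.measurable_rnDeriv _ _
  set L := lam (closedBall (0 : W) δ)
  have hLv : ∀ v : W, lam (closedBall v δ) = L := fun v =>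
    Measure.addHaar_closedBall_center lam v δ
  have hball : ∀ v : W, α (closedBall v δ) = ∫⁻ u in closedBall (0 : W) δ, f (v + u) ∂lam := by
    intro v
    rw [← Measure.withDensity_rnDeriv_eq α lam hα,
      withDensity_apply _ measurableSet_closedBall, ← hf,
      ← lintegral_indicator measurableSet_closedBall,
      ← lintegral_indicator measurableSet_closedBall, ← lintegral_add_left_eq_self _ v]
    refine lintegral_congr fun u => ?_
    simp [Set.indicator]
  have hprod : Measurable fun p : W × W => f (p.1 + p.2) := hfm.comp (by fun_prop)
  have hβ' : ∀ h : W → ℝ≥0∞, Measurable h → ∫⁻ v, h v ∂β = ∫⁻ v, g v * h v ∂lam := by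
    intro h hh
    rw [← Measure.withDensity_rnDeriv_eq β lam hβ, lintegral_withDensity_eq_lintegral_mul _ hgm hh]
    rfl
  have key : 2 * ∫⁻ v, α (closedBall v δ) ∂β ≤
      L * (∫⁻ v, f v ^ 2 ∂lam + ∫⁻ v, g v ^ 2 ∂lam) := by
    calc 2 * ∫⁻ v, α (closedBall v δ) ∂β
        = ∫⁻ v, ∫⁻ u in closedBall (0 : W) δ, 2 * (f (v + u) * g v) ∂lam ∂lam := by
          rw [hβ' _ (measurable_measure_closedBall α δ),
            ← lintegral_const_mul _ (f := fun v => g v * α (closedBall v δ))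
              (hgm.mul (measurable_measure_closedBall α δ))]
          refine lintegral_congr fun v => ?_
          rw [hball, lintegral_const_mul _ (by fun_prop), lintegral_mul_const _ (by fun_prop),
            mul_comm (g v)]
      _ = ∫⁻ u in closedBall (0 : W) δ, ∫⁻ v, 2 * (f (v + u) * g v) ∂lam ∂lam :=
          lintegral_lintegral_swap (by fun_prop)
      _ ≤ ∫⁻ u in closedBall (0 : W) δ, ∫⁻ v, (f (v + u) ^ 2 + g v ^ 2) ∂lam ∂lam := by
          gcongr
          exact two_mul_mul_le_sq_add_sq _ _
      _ = ∫⁻ u in closedBall (0 : W) δ, (∫⁻ v, f v ^ 2 ∂lam + ∫⁻ v, g v ^ 2 ∂lam) ∂lam := by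
          refine lintegral_congr fun u => ?_
          rw [lintegral_add_left (by fun_prop), lintegral_add_right_eq_self (fun v => f v ^ 2)]
      _ = L * (∫⁻ v, f v ^ 2 ∂lam + ∫⁻ v, g v ^ 2 ∂lam) := by
          rw [lintegral_const, Measure.restrict_apply_univ, mul_comm]
  have hE : ballEnergy lam δ α β = (∫⁻ v, α (closedBall v δ) ∂β) / L := by
    simp only [ballEnergy, hLv, div_eq_mul_inv]
    rw [lintegral_mul_const _ (measurable_measure_closedBall α δ)]
  rw [hE, ← mul_div_assoc]
  exact ENNReal.div_le_of_le_mul' key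

theorem ballEnergy_self_le (α : Measure W) [IsFiniteMeasure α] (δ : ℝ) :
    ballEnergy lam δ α α ≤ densityEnergy lam α := by
  have h := two_mul_ballEnergy_le lam α α δ
  rw [← two_mul] at h
  exact (ENNReal.mul_le_mul_iff_right two_ne_zero ENNReal.ofNat_ne_top).1 h

/-- Fatou reduces this to the pointwise limit of the ball ratios `α(B) / λ(B)`. If `α ≪ lam` they
tend `α`-a.e. to the density `f`, and `∫ f dα = ∫ f² dλ`. Otherwise they tend to `∞` on a set of
positive `α`-measure. -/
theorem densityEnergy_le_liminf_ballEnergy (α : Measure W) [IsFiniteMeasure α] {δ : ℕ → ℝ}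
    (hδ : ∀ k, 0 < δ k) (hδ0 : Tendsto δ atTop (𝓝 0)) :
    densityEnergy lam α ≤ liminf (fun k => ballEnergy lam (δ k) α α) atTop := by
  have hδ' : Tendsto δ atTop (𝓝[>] 0) :=
    tendsto_nhdsWithin_iff.2 ⟨hδ0, Eventually.of_forall hδ⟩
  have hLv : ∀ (v : W) δ, lam (closedBall v δ) = lam (closedBall (0 : W) δ) := fun v δ =>
    Measure.addHaar_closedBall_center lam v δ
  have hmeas : ∀ k, Measurable fun v => α (closedBall v (δ k)) / lam (closedBall v (δ k)) := by
    intro k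
    simp only [hLv]
    exact (measurable_measure_closedBall α _).div_const _
  refine le_trans ?_ (lintegral_liminf_le hmeas)
  by_cases hα : α ≪ lam
  · simp only [densityEnergy, hα, if_true]
    have h1 : ∫⁻ v, α.rnDeriv lam v ^ 2 ∂lam = ∫⁻ v, α.rnDeriv lam v ∂α := by
      conv_rhs => rw [← Measure.withDensity_rnDeriv_eq α lam hα]
      rw [lintegral_withDensity_eq_lintegral_mul _ (Measure.measurable_rnDeriv _ _)]
      · simp [sq, Measure.withDensity_rnDeriv_eq α lam hα]
      · exact Measure.measurable_rnDeriv _ _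
    rw [h1]
    refine lintegral_mono_ae ?_
    filter_upwards [hα.ae_le (Besicovitch.ae_tendsto_rnDeriv α lam)] with v hv
    exact (hv.comp hδ').liminf_eq.ge
  · obtain ⟨N, hNm, hN0, hNα⟩ : ∃ N, MeasurableSet N ∧ lam N = 0 ∧ α N ≠ 0 := by
      by_contra! h
      exact hα (Measure.AbsolutelyContinuous.mk fun s hs h0 => h s hs h0)
    -- Differentiate in the other direction: `dλ/dα` has integral at most `λ(N) = 0` over `N`, so
    -- there the ratios `λ(B) / α(B)` tend to `0` and their inverses to `∞`.
    have hz : ∀ᵐ v ∂α.restrict N, lam.rnDeriv α v = 0 := by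
      refine (lintegral_eq_zero_iff (Measure.measurable_rnDeriv lam α)).1 ?_
      exact le_antisymm ((Measure.setLIntegral_rnDeriv_le N).trans hN0.le) zero_le
    have htop : ∀ᵐ v ∂α.restrict N,
        liminf (fun k => α (closedBall v (δ k)) / lam (closedBall v (δ k))) atTop = ∞ := by
      filter_upwards [hz, ae_restrict_of_ae (Besicovitch.ae_tendsto_rnDeriv lam α)] with v h0 hv
      rw [h0] at hv
      have h2 := (continuous_inv.tendsto (0 : ℝ≥0∞)).comp (hv.comp hδ')
      rw [ENNReal.inv_zero] at h2
      refine Tendsto.liminf_eq (h2.congr fun k => ?_)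
      simp only [Function.comp]
      rw [ENNReal.inv_div (Or.inl (measure_ne_top _ _))
        (Or.inr (measure_closedBall_pos lam v (hδ k)).ne')]
    calc densityEnergy lam α ≤ ∞ := le_top
      _ = ∫⁻ v in N, ∞ ∂α := by simp [hNα, ENNReal.top_mul]
      _ = ∫⁻ v in N, liminf (fun k => α (closedBall v (δ k)) / lam (closedBall v (δ k))) atTop ∂α :=
          lintegral_congr_ae (by filter_upwards [htop] with v hv using hv.symm)
      _ ≤ _ := setLIntegral_le_lintegral _ _

theorem tendsto_ballEnergy (α : Measure W) [IsFiniteMeasure α] {δ : ℕ → ℝ}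
    (hδ : ∀ k, 0 < δ k) (hδ0 : Tendsto δ atTop (𝓝 0)) :
    Tendsto (fun k => ballEnergy lam (δ k) α α) atTop (𝓝 (densityEnergy lam α)) :=
  tendsto_of_le_liminf_of_limsup_le (densityEnergy_le_liminf_ballEnergy lam α hδ hδ0)
    (limsup_le_of_le (by isBoundedDefault)
      (Eventually.of_forall fun k => ballEnergy_self_le lam α (δ k)))

end Pointwise

/-! ### The probability that a random projection of a vector is short. -/

section Grassmannian

variable {n m : ℕ}

instance : SecondCountableTopology (Gr n m) :=
  have : ProperSpace (E n →L[ℝ] E n) := FiniteDimensional.proper ℝ _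
  TopologicalSpace.secondCountableTopology_induced _ _ _

theorem norm_proj (V : Gr n m) (z : E n) : ‖proj V z‖ = ‖V.1.starProjection z‖ := rfl

theorem continuous_norm_proj : Continuous fun p : Gr n m × E n => ‖proj p.1 p.2‖ := by
  have h : Continuous fun V : Gr n m => V.1.starProjection := continuous_induced_dom
  simp only [norm_proj]
  exact ((h.comp continuous_fst).clm_apply continuous_snd).norm

theorem norm_proj_rot (g : O n) (V : Gr n m) (z : E n) :
    ‖proj (rot g V) z‖ = ‖V.1.starProjection (star (g : E n →L[ℝ] E n) z)‖ := by
  rw [norm_proj, starProjection_rot]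
  exact (Unitary.linearIsometryEquiv g).norm_map _

/-- The measure of the set of planes on which the projection of `z` has length at most `δ`. -/
noncomputable def smallProj (h : m ≤ n) (δ : ℝ) (z : E n) : ℝ≥0∞ :=
  grMeasure h {V | ‖proj V z‖ ≤ δ}

theorem measurableSet_smallProj (δ : ℝ) (z : E n) : MeasurableSet {V : Gr n m | ‖proj V z‖ ≤ δ} :=
  (isClosed_le (continuous_norm_proj.comp (by fun_prop : Continuous fun V : Gr n m => (V, z)))
    continuous_const).measurableSet

theorem smallProj_eq_haarO (h : m ≤ n) (δ : ℝ) (z : E n) :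
    smallProj h δ z = haarO n
      {g | ‖(coordPlane h).1.starProjection (star (g : E n →L[ℝ] E n) z)‖ ≤ δ} := by
  rw [smallProj, grMeasure, Measure.map_apply (continuous_rot _).measurable
    (measurableSet_smallProj δ z)]
  simp only [Set.preimage_ofPred_eq, norm_proj_rot]

instance : (haarO n).IsMulLeftInvariant := by
  unfold haarO; infer_instance

/-- The reflection in the hyperplane orthogonal to `z - w` takes `z` to `w`, and Haar measure is
left invariant. -/
theorem smallProj_congr_norm (h : m ≤ n) (δ : ℝ) {z w : E n} (hzw : ‖z‖ = ‖w‖) :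
    smallProj h δ z = smallProj h δ w := by
  let R : O n := Unitary.linearIsometryEquiv.symm (Submodule.reflection (ℝ ∙ (z - w))ᗮ)
  have hR : (R : E n →L[ℝ] E n) z = w := Submodule.reflection_sub hzw
  rw [smallProj_eq_haarO, smallProj_eq_haarO]
  rw [← measure_preimage_mul (haarO n) R
    {g | ‖(coordPlane h).1.starProjection (star (g : E n →L[ℝ] E n) w)‖ ≤ δ}]
  congr 1
  ext g
  simp only [Set.mem_ofPred_eq, Set.mem_preimage, Submonoid.coe_mul, star_mul]
  have : (star (g : E n →L[ℝ] E n) * star (R : E n →L[ℝ] E n)) w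
      = star (g : E n →L[ℝ] E n) z := by
    rw [← hR, ← mul_apply_eq_comp, mul_assoc, Unitary.coe_star_mul_self, mul_one]
  rw [this]

theorem smallProj_smul (h : m ≤ n) (δ : ℝ) (z : E n) {r : ℝ} (hr : 0 < r) :
    smallProj h δ (r • z) = smallProj h (δ / r) z := by
  simp only [smallProj, map_smul, norm_smul, Real.norm_of_nonneg hr.le, le_div_iff₀' hr]

/-- By scaling, both sides are the value at radius `ε` of vectors of the same length `‖x‖ ‖z‖`. -/
theorem smallProj_div_norm_comm (h : m ≤ n) (ε : ℝ) {x z : E n} (hx : x ≠ 0) (hz : z ≠ 0) :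
    smallProj h (ε / ‖x‖) z = smallProj h (ε / ‖z‖) x := by
  rw [← smallProj_smul h ε z (norm_pos_iff.2 hx), ← smallProj_smul h ε x (norm_pos_iff.2 hz)]
  refine smallProj_congr_norm h ε ?_
  simp only [norm_smul, norm_norm, mul_comm]

/-- Write the probability as an integral over `O(n)` and swap: each rotation preserves both volume
and `Φ ‖x‖`, so every `g` contributes the same integral over the fixed slab. -/
theorem lintegral_smallProj_mul (h : m ≤ n) (δ : ℝ) {Φ : ℝ → ℝ≥0∞} (hΦ : Measurable Φ) :
    ∫⁻ x : E n, smallProj h δ x * Φ ‖x‖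
      = ∫⁻ x in {x : E n | ‖(coordPlane h).1.starProjection x‖ ≤ δ}, Φ ‖x‖ := by
  set A : Set (E n) := {x : E n | ‖(coordPlane h).1.starProjection x‖ ≤ δ} with hA
  have hAm : MeasurableSet A := (isClosed_le (by fun_prop) continuous_const).measurableSet
  have hcont : Continuous fun p : E n × O n => star (p.2 : E n →L[ℝ] E n) p.1 := by fun_prop
  have hind : ∀ x : E n, smallProj h δ x * Φ ‖x‖
      = ∫⁻ g : O n, A.indicator (fun x => Φ ‖x‖) (star (g : E n →L[ℝ] E n) x) ∂haarO n := by
    intro x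
    have hS : MeasurableSet ((fun g : O n => star (g : E n →L[ℝ] E n) x) ⁻¹' A) :=
      (hcont.comp (by fun_prop : Continuous fun g : O n => (x, g))).measurable hAm
    have : ∀ g : O n, A.indicator (fun x => Φ ‖x‖) (star (g : E n →L[ℝ] E n) x)
        = ((fun g : O n => star (g : E n →L[ℝ] E n) x) ⁻¹' A).indicator (fun _ => Φ ‖x‖) g := by
      intro g
      have hn : ‖star (g : E n →L[ℝ] E n) x‖ = ‖x‖ :=
        (Unitary.linearIsometryEquiv (star g)).norm_map x
      simp only [Set.indicator, Set.mem_preimage, hn]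
    simp only [this]
    rw [lintegral_indicator_const hS, smallProj_eq_haarO, mul_comm]
    rfl
  have hm : Measurable (A.indicator fun x : E n => Φ ‖x‖) :=
    (hΦ.comp measurable_norm).indicator hAm
  calc ∫⁻ x : E n, smallProj h δ x * Φ ‖x‖
      = ∫⁻ x : E n, ∫⁻ g : O n,
          A.indicator (fun x => Φ ‖x‖) (star (g : E n →L[ℝ] E n) x) ∂haarO n := by
        simp only [hind]
    _ = ∫⁻ g : O n, (∫⁻ x : E n,
          A.indicator (fun x => Φ ‖x‖) (star (g : E n →L[ℝ] E n) x)) ∂haarO n :=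
        lintegral_lintegral_swap (hm.comp hcont.measurable).aemeasurable
    _ = ∫⁻ g : O n, (∫⁻ x : E n, A.indicator (fun x => Φ ‖x‖) x) ∂haarO n := by
        refine lintegral_congr fun g => ?_
        exact (Unitary.linearIsometryEquiv (star g)).measurePreserving.lintegral_comp hm
    _ = ∫⁻ x in A, Φ ‖x‖ := by
        rw [lintegral_const, measure_univ, mul_one, lintegral_indicator hAm]

end Grassmannian

/-! ### Linear rescaling of a slab to unit width. -/

section Stretch

variable {n m : ℕ}

/-- Scaling by `t` along the coordinate plane, the identity on its orthogonal complement. -/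
noncomputable def stretch (h : m ≤ n) (t : ℝ) : E n →ₗ[ℝ] E n :=
  t • (coordPlane h).1.starProjection.toLinearMap
    + (LinearMap.id - (coordPlane h).1.starProjection.toLinearMap)

theorem stretch_apply (h : m ≤ n) (t : ℝ) (x : E n) :
    stretch h t x = t • (coordPlane h).1.starProjection x
      + (x - (coordPlane h).1.starProjection x) := rfl

theorem starProjection_coordPlane_basis (h : m ≤ n) (i : Fin n) :
    (coordPlane h).1.starProjection (EuclideanSpace.basisFun (Fin n) ℝ i)
      = if (i : ℕ) < m then EuclideanSpace.basisFun (Fin n) ℝ i else 0 := by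
  split_ifs with hi
  · refine Submodule.starProjection_eq_self_iff.2 (Submodule.subset_span ⟨⟨i, hi⟩, ?_⟩)
    rfl
  · rw [Submodule.starProjection_apply_eq_zero_iff, Submodule.mem_orthogonal]
    intro u hu
    induction hu using Submodule.span_induction with
    | mem x hx =>
      obtain ⟨j, rfl⟩ := hx
      refine (EuclideanSpace.basisFun (Fin n) ℝ).orthonormal.2 ?_
      intro hij
      exact hi (hij ▸ j.2)
    | zero => simp
    | add x y _ _ hx hy => rw [inner_add_left, hx, hy, add_zero]
    | smul a x _ hx => rw [inner_smul_left, hx, mul_zero]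

theorem det_stretch (h : m ≤ n) (t : ℝ) : LinearMap.det (stretch h t) = t ^ m := by
  set b := (EuclideanSpace.basisFun (Fin n) ℝ).toBasis
  have hb : LinearMap.toMatrix b b (stretch h t)
      = Matrix.diagonal fun i : Fin n => if (i : ℕ) < m then t else 1 := by
    ext i j
    have : stretch h t (b j) = (if (j : ℕ) < m then t else 1) • b j := by
      have h1 := starProjection_coordPlane_basis h j
      rw [stretch_apply]
      simp only [b, OrthonormalBasis.coe_toBasis, h1]
      split_ifs <;> simp
    rw [LinearMap.toMatrix_apply, this, map_smul, Module.Basis.repr_self, Finsupp.smul_apply,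
      smul_eq_mul]
    rcases eq_or_ne i j with rfl | hij
    · simp
    · simp [Matrix.diagonal_apply_ne _ hij, Finsupp.single_eq_of_ne hij]
  rw [← LinearMap.det_toMatrix b, hb, Matrix.det_diagonal, Finset.prod_ite]
  simp only [Finset.prod_const, one_pow, mul_one]
  congr 1
  rw [← Fintype.card_subtype, Fintype.card_fin_lt_of_le h]

theorem starProjection_stretch (h : m ≤ n) (t : ℝ) (x : E n) :
    (coordPlane h).1.starProjection (stretch h t x)
      = t • (coordPlane h).1.starProjection x := by
  have hi : ∀ y, (coordPlane h).1.starProjection ((coordPlane h).1.starProjection y)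
      = (coordPlane h).1.starProjection y := fun y =>
    Submodule.starProjection_eq_self_iff.2 (Submodule.starProjection_apply_mem _ _)
  rw [stretch_apply]
  simp [hi]

/-- The stretch leaves the component orthogonal to the plane unchanged. This gives control uniform
in `t`. -/
theorem norm_sub_starProjection_le (h : m ≤ n) (t : ℝ) (x : E n) :
    ‖x - (coordPlane h).1.starProjection x‖ ≤ ‖stretch h t x‖ := by
  have : x - (coordPlane h).1.starProjection x
      = (coordPlane h).1ᗮ.starProjection (stretch h t x) := by
    rw [Submodule.starProjection_orthogonal_val, starProjection_stretch, stretch_apply]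
    abel
  rw [this]
  exact Submodule.norm_starProjection_apply_le _ _

/-- Change of variables with determinant `t ^ m`. With `t = ε / ‖z‖`, this factor cancels the
normalization `ε ^ m` and leaves the Riesz kernel `‖z‖ ^ (-m)`. -/
theorem setLIntegral_stretch (h : m ≤ n) {t : ℝ} (ht : 0 < t) {Φ : E n → ℝ≥0∞}
    (hΦ : Measurable Φ) :
    ∫⁻ x in {x : E n | ‖(coordPlane h).1.starProjection x‖ ≤ t}, Φ x
      = ENNReal.ofReal (t ^ m) *
        ∫⁻ x in {x : E n | ‖(coordPlane h).1.starProjection x‖ ≤ 1}, Φ (stretch h t x) := by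
  have hdet : LinearMap.det (stretch h t) ≠ 0 := by rw [det_stretch]; positivity
  have hmap := Measure.map_linearMap_addHaar_eq_smul_addHaar (volume : Measure (E n)) hdet
  have hAm : ∀ s : ℝ, MeasurableSet {x : E n | ‖(coordPlane h).1.starProjection x‖ ≤ s} := fun s =>
    (isClosed_le (by fun_prop) continuous_const).measurableSet
  have hc : Continuous (stretch h t) := LinearMap.continuous_of_finiteDimensional _
  rw [← lintegral_indicator (hAm t), ← lintegral_indicator (hAm 1)]
  have h1 : ∀ x : E n, {x : E n | ‖(coordPlane h).1.starProjection x‖ ≤ 1}.indicator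
      (fun x => Φ (stretch h t x)) x
      = {x : E n | ‖(coordPlane h).1.starProjection x‖ ≤ t}.indicator Φ (stretch h t x) := by
    intro x
    simp only [Set.indicator, Set.mem_ofPred_eq, starProjection_stretch, norm_smul,
      Real.norm_of_nonneg ht.le, mul_le_iff_le_one_right ht]
  simp only [h1]
  rw [← lintegral_map (hΦ.indicator (hAm t)) hc.measurable, hmap, lintegral_smul_measure,
    smul_eq_mul, ← mul_assoc, det_stretch, ← ENNReal.ofReal_mul (by positivity),
    abs_of_pos (by positivity), mul_inv_cancel₀ (by positivity), ENNReal.ofReal_one, one_mul]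

end Stretch

/-! ### The radius-averaged kernel and its Riesz limit. -/

section Kernel

variable {n m : ℕ}

/-- A bump function times the `m`-th power, as a function of the radius. -/
noncomputable def radialBump (m : ℕ) (r : ℝ) : ℝ≥0∞ :=
  ENNReal.ofReal (1 - r) * ENNReal.ofReal (r ^ m)

theorem continuous_radialBump (m : ℕ) : Continuous (radialBump m) := by
  have h : Continuous fun r : ℝ => ENNReal.ofReal ((max (1 - r) 0) * r ^ m) :=
    ENNReal.continuous_ofReal.comp (by fun_prop)
  refine h.congr fun r => ?_
  rw [ENNReal.ofReal_mul (le_max_right _ _), radialBump]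
  simp

theorem radialBump_le_one (m : ℕ) {r : ℝ} (hr : 0 ≤ r) : radialBump m r ≤ 1 := by
  rcases le_total r 1 with h | h
  · rw [radialBump, ← ENNReal.ofReal_mul (by linarith), ENNReal.ofReal_le_one]
    exact mul_le_one₀ (by linarith) (by positivity) (pow_le_one₀ hr h)
  · simp [radialBump, ENNReal.ofReal_of_nonpos (sub_nonpos.2 h)]

theorem radialBump_eq_zero (m : ℕ) {r : ℝ} (hr : 1 ≤ r) : radialBump m r = 0 := by
  simp [radialBump, ENNReal.ofReal_of_nonpos (sub_nonpos.2 hr)]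

theorem radialBump_pos (m : ℕ) {r : ℝ} (hr0 : 0 < r) (hr1 : r < 1) : 0 < radialBump m r :=
  ENNReal.mul_pos (by simpa using hr1) (by simpa using pow_pos hr0 m)

/-- The set of points whose projection to the coordinate plane has norm at most one. -/
def tube (h : m ≤ n) : Set (E n) := {x : E n | ‖(coordPlane h).1.starProjection x‖ ≤ 1}

theorem measurableSet_tube (h : m ≤ n) : MeasurableSet (tube h) :=
  (isClosed_le (by fun_prop) continuous_const).measurableSet

/-- The integral over the tube of the radial bump precomposed with the stretch by `t`. -/
noncomputable def tubeIntegral (h : m ≤ n) (t : ℝ) : ℝ≥0∞ :=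
  ∫⁻ x in tube h, radialBump m ‖stretch h t x‖

/-- The tube is unbounded, but a point of it with `‖x‖ > 2` has orthogonal component longer than
`1`, where the bump vanishes. The resulting integrable majorant does not depend on `t`. -/
theorem radialBump_stretch_le (h : m ≤ n) (t : ℝ) {x : E n} (hx : x ∈ tube h) :
    radialBump m ‖stretch h t x‖ ≤ (closedBall (0 : E n) 2).indicator 1 x := by
  by_cases hx2 : x ∈ closedBall (0 : E n) 2
  · rw [Set.indicator_of_mem hx2]
    exact radialBump_le_one m (norm_nonneg _)
  · rw [Set.indicator_of_notMem hx2, radialBump_eq_zero]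
    refine le_trans ?_ (norm_sub_starProjection_le h t x)
    rw [mem_closedBall_zero_iff, not_le] at hx2
    have h1 : ‖(coordPlane h).1.starProjection x‖ ≤ 1 := hx
    have h2 := norm_sub_norm_le x ((coordPlane h).1.starProjection x)
    linarith

theorem lintegral_indicator_closedBall_two_lt_top :
    ∫⁻ x : E n, (closedBall (0 : E n) 2).indicator 1 x < ∞ := by
  rw [lintegral_indicator_one measurableSet_closedBall]
  exact measure_closedBall_lt_top

theorem tubeIntegral_le (h : m ≤ n) (t : ℝ) :
    tubeIntegral h t ≤ ∫⁻ x : E n, (closedBall (0 : E n) 2).indicator 1 x :=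
  (setLIntegral_mono' (measurableSet_tube h) fun _ hx => radialBump_stretch_le h t hx).trans
    (setLIntegral_le_lintegral _ _)

theorem measurable_radialBump_stretch (h : m ≤ n) (t : ℝ) :
    Measurable fun x : E n => radialBump m ‖stretch h t x‖ :=
  ((continuous_radialBump m).comp
    (LinearMap.continuous_of_finiteDimensional (stretch h t)).norm).measurable

theorem tendsto_tubeIntegral (h : m ≤ n) {t : ℕ → ℝ} (ht : Tendsto t atTop (𝓝 0)) :
    Tendsto (fun k => tubeIntegral h (t k)) atTop (𝓝 (tubeIntegral h 0)) := by
  refine tendsto_lintegral_of_dominated_convergence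
    ((closedBall (0 : E n) 2).indicator 1) (fun k => measurable_radialBump_stretch h (t k))
    (fun k => ?_) ?_ ?_
  · filter_upwards [ae_restrict_mem (measurableSet_tube h)] with x hx
    exact radialBump_stretch_le h _ hx
  · exact ((setLIntegral_le_lintegral _ _).trans_lt lintegral_indicator_closedBall_two_lt_top).ne
  · refine Eventually.of_forall fun x => ?_
    have hc : Continuous fun s : ℝ => radialBump m ‖stretch h s x‖ := by
      refine (continuous_radialBump m).comp (Continuous.norm ?_)
      simp only [stretch_apply]
      fun_prop
    exact (hc.tendsto 0).comp ht

theorem stretch_zero (h : m ≤ n) (x : E n) :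
    stretch h 0 x = x - (coordPlane h).1.starProjection x := by
  rw [stretch_apply, zero_smul, zero_add]

/-- For `m < n` the orthogonal complement is nontrivial, so the tube contains a nonempty open set of
points whose orthogonal component has length in `(0, 1)`, where the bump is positive. -/
theorem tubeIntegral_zero_pos (h : m < n) : 0 < tubeIntegral h.le 0 := by
  set V := (coordPlane h.le).1 with hV
  have hVtop : Vᗮ ≠ ⊥ := by
    rw [Ne, Submodule.orthogonal_eq_bot_iff]
    intro htop
    have h1 : Module.finrank ℝ V = m := (coordPlane h.le).2
    rw [htop, finrank_top, finrank_euclideanSpace_fin] at h1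
    omega
  obtain ⟨w, hw, hw0⟩ := Submodule.exists_mem_ne_zero_of_ne_bot hVtop
  set U : Set (E n) := {x | ‖V.starProjection x‖ < 1 ∧
    0 < ‖x - V.starProjection x‖ ∧ ‖x - V.starProjection x‖ < 1} with hU
  have hUo : IsOpen U := by
    have h1 : Continuous fun x : E n => ‖V.starProjection x‖ := by fun_prop
    have h2 : Continuous fun x : E n => ‖x - V.starProjection x‖ := by fun_prop
    exact (isOpen_lt h1 continuous_const).inter
      ((isOpen_lt continuous_const h2).inter (isOpen_lt h2 continuous_const))
  have hUne : U.Nonempty := by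
    refine ⟨(2 * ‖w‖)⁻¹ • w, ?_⟩
    have hn : 0 < ‖w‖ := norm_pos_iff.2 hw0
    have hp : V.starProjection ((2 * ‖w‖)⁻¹ • w) = 0 :=
      (Submodule.starProjection_apply_eq_zero_iff _).2 (Submodule.smul_mem _ _ hw)
    have hnorm : ‖(2 * ‖w‖)⁻¹ • w‖ = 1 / 2 := by
      rw [norm_smul, Real.norm_of_nonneg (by positivity)]
      field_simp
    simp only [hU, Set.mem_ofPred_eq, hp, sub_zero, hnorm, norm_zero]
    norm_num
  rw [pos_iff_ne_zero]
  intro h0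
  rw [tubeIntegral, lintegral_eq_zero_iff (measurable_radialBump_stretch h.le 0)] at h0
  refine (hUo.measure_pos volume hUne).ne' ?_
  have h1 := (ae_restrict_iff' (measurableSet_tube h.le)).1 h0
  refine measure_mono_null (fun x hx => ?_) (ae_iff.1 h1)
  simp only [Set.mem_ofPred_eq, Classical.not_imp, Pi.zero_apply, stretch_zero]
  exact ⟨hx.1.le, (radialBump_pos m hx.2.1 hx.2.2).ne'⟩

/-- Here the plane is the whole space, the stretch by `0` is the zero map, and the factor `r ^ m`
kills the bump at `0`. -/
theorem tubeIntegral_self_zero (hm : 0 < m) : tubeIntegral (le_refl m) 0 = 0 := by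
  have htop : (coordPlane (le_refl m)).1 = ⊤ := by
    refine Submodule.eq_top_of_finrank_eq ?_
    rw [finrank_euclideanSpace_fin]
    exact (coordPlane (le_refl m)).2
  have : ∀ x : E m, radialBump m ‖stretch (le_refl m) 0 x‖ = 0 := by
    intro x
    have hx : (coordPlane (le_refl m)).1.starProjection x = x :=
      Submodule.starProjection_eq_self_iff.2 (htop ▸ Submodule.mem_top)
    simp [stretch_zero, hx, radialBump, hm.ne']
  simp [tubeIntegral, this]

theorem monotone_smallProj (h : m ≤ n) (z : E n) : Monotone fun δ => smallProj h δ z :=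
  fun _ _ hab => measure_mono fun _ hV => le_trans hV hab

/-- The average over the radii `ε * s`, with `s` distributed by `ρ`, of the normalized measure of
the set of planes on which the projection of `z` is small. -/
noncomputable def averagedKernel (h : m ≤ n) (ρ : Measure ℝ) (ε : ℝ) (z : E n) : ℝ≥0∞ :=
  ∫⁻ s, smallProj h (ε * s) z / ENNReal.ofReal ((ε * s) ^ m) ∂ρ

/-- The distribution of `‖x‖⁻¹` under the measure with density `1 - ‖x‖` on the unit ball. -/
noncomputable def radiusLaw (n : ℕ) : Measure ℝ :=
  ((volume : Measure (E n)).withDensity fun x => ENNReal.ofReal (1 - ‖x‖)).map fun x => ‖x‖⁻¹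

/-- The weight `‖x‖ ^ m` produced by the normalization at radius `ε / ‖x‖` turns the density `1 -
‖x‖` into the radial bump. Exchanging `x` and `z` makes the average an integral over a slab of
half-width `ε / ‖z‖`, which the stretch rescales. -/
theorem averagedKernel_radiusLaw (hn : 0 < n) (h : m ≤ n) {ε : ℝ} (hε : 0 < ε) {z : E n}
    (hz : z ≠ 0) :
    averagedKernel h (radiusLaw n) ε z
      = edist z 0 ^ (-(m : ℝ)) * tubeIntegral h (ε / ‖z‖) := by
  have : Nonempty (Fin n) := ⟨⟨0, hn⟩⟩
  have hz' : 0 < ‖z‖ := norm_pos_iff.2 hz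
  have hmeas : Measurable fun s : ℝ =>
      smallProj h (ε * s) z / ENNReal.ofReal ((ε * s) ^ m) :=
    ((monotone_smallProj h z).measurable.comp (measurable_const_mul ε)).div (by fun_prop)
  have hG : Measurable fun x : E n => ENNReal.ofReal (1 - ‖x‖) := by fun_prop
  have hε0 : ENNReal.ofReal (ε ^ m) ≠ 0 := by simpa using pow_pos hε m
  rw [averagedKernel, radiusLaw, lintegral_map hmeas (by fun_prop),
    lintegral_withDensity_eq_lintegral_mul _ hG
      (g := fun x => smallProj h (ε * ‖x‖⁻¹) z / ENNReal.ofReal ((ε * ‖x‖⁻¹) ^ m))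
      (hmeas.comp (by fun_prop : Measurable fun x : E n => ‖x‖⁻¹))]
  simp only [Pi.mul_apply]
  have hx : ∀ᵐ x : E n, ENNReal.ofReal (1 - ‖x‖) *
      (smallProj h (ε * ‖x‖⁻¹) z / ENNReal.ofReal ((ε * ‖x‖⁻¹) ^ m))
      = (ENNReal.ofReal (ε ^ m))⁻¹ * (smallProj h (ε / ‖z‖) x * radialBump m ‖x‖) := by
    have h0 : ∀ᵐ x : E n, x ≠ 0 := by
      simp [ae_iff]
    filter_upwards [h0] with x hx0
    have hx' : 0 < ‖x‖ := norm_pos_iff.2 hx0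
    have h1 : ENNReal.ofReal ((ε * ‖x‖⁻¹) ^ m)
        = ENNReal.ofReal (ε ^ m) / ENNReal.ofReal (‖x‖ ^ m) := by
      rw [← ENNReal.ofReal_div_of_pos (by positivity), mul_pow, inv_pow, div_eq_mul_inv]
    rw [h1, ← div_eq_mul_inv ε, smallProj_div_norm_comm h ε hx0 hz,
      radialBump, ENNReal.div_eq_inv_mul, ENNReal.inv_div (Or.inl ENNReal.ofReal_ne_top)
      (Or.inl (ENNReal.ofReal_pos.2 (pow_pos hx' m)).ne'), div_eq_mul_inv]
    ring
  rw [lintegral_congr_ae hx, lintegral_const_mul' _ _ (ENNReal.inv_ne_top.2 hε0),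
    lintegral_smallProj_mul h _ (continuous_radialBump m).measurable,
    setLIntegral_stretch h (div_pos hε hz') (Φ := fun x => radialBump m ‖x‖)
      ((continuous_radialBump m).comp continuous_norm).measurable, ← mul_assoc]
  congr 1
  rw [edist_zero_right, ← ofReal_norm, ENNReal.ofReal_rpow_of_pos hz', div_pow,
    ENNReal.ofReal_div_of_pos (by positivity), ← mul_div_assoc,
    ENNReal.inv_mul_cancel hε0 ENNReal.ofReal_ne_top, Real.rpow_neg hz'.le, Real.rpow_natCast,
    ENNReal.ofReal_inv_of_pos (by positivity), one_div]

theorem smallProj_zero_dim (h : 0 ≤ n) {δ : ℝ} (hδ : 0 ≤ δ) (z : E n) :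
    smallProj h δ z = 1 := by
  have : {V : Gr n 0 | ‖proj V z‖ ≤ δ} = Set.univ := by
    refine Set.eq_univ_of_forall fun V => ?_
    have hV : V.1 = ⊥ := Submodule.finrank_eq_zero.1 V.2
    have hz : V.1.starProjection z = 0 := by
      have hmem := Submodule.starProjection_apply_mem V.1 z
      exact (Submodule.mem_bot ℝ).1 (hV.le hmem)
    rw [Set.mem_ofPred_eq, norm_proj, hz, norm_zero]
    exact hδ
  rw [smallProj, this, measure_univ]

/-- The averaged kernel is comparable to, and in the limit proportional to, the Riesz kernel. -/
theorem exists_averagedKernel (h : m ≤ n) :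
    ∃ (ρ : Measure ℝ) (C c : ℝ≥0∞), IsFiniteMeasure ρ ∧ ρ ≠ 0 ∧ (∀ᵐ s ∂ρ, 0 < s) ∧
      C < ∞ ∧ c < ∞ ∧ ((m < n ∨ m = 0) → 0 < c) ∧ (m = n → 0 < m → c = 0) ∧
      ∀ z : E n, (z ≠ 0 ∨ m = 0) →
        (∀ ε > 0, averagedKernel h ρ ε z ≤ C * edist z 0 ^ (-(m : ℝ))) ∧
        ∀ ε : ℕ → ℝ, (∀ k, 0 < ε k) → Tendsto ε atTop (𝓝 0) →
          Tendsto (fun k => averagedKernel h ρ (ε k) z) atTop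
            (𝓝 (c * edist z 0 ^ (-(m : ℝ)))) := by
  rcases Nat.eq_zero_or_pos m with rfl | hm
  -- For `m = 0` every projection is zero, so a single radius suffices and the kernel is identically
  -- `1`, even at `z = 0`.
  · have hK : ∀ (ε : ℝ) (z : E n), 0 < ε → averagedKernel h (Measure.dirac 1) ε z = 1 := by
      intro ε z hε
      simp [averagedKernel, smallProj_zero_dim h hε.le]
    refine ⟨Measure.dirac 1, 1, 1, inferInstance, IsProbabilityMeasure.ne_zero _, by simp,
      ENNReal.one_lt_top, ENNReal.one_lt_top, by simp, by simp, fun z _ => ⟨?_, ?_⟩⟩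
    · intro ε hε
      simp [hK ε z hε]
    · intro ε hε _
      simp [hK _ z (hε _)]
  · have hn : 0 < n := hm.trans_le h
    have : Nonempty (Fin n) := ⟨⟨0, hn⟩⟩
    have hG : Measurable fun x : E n => ENNReal.ofReal (1 - ‖x‖) := by fun_prop
    have hle : ∀ x : E n, ENNReal.ofReal (1 - ‖x‖) ≤ (closedBall (0 : E n) 2).indicator 1 x := by
      intro x
      by_cases hx : x ∈ closedBall (0 : E n) 2
      · rw [Set.indicator_of_mem hx]
        simp
      · rw [Set.indicator_of_notMem hx, ENNReal.ofReal_of_nonpos]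
        rw [mem_closedBall_zero_iff, not_le] at hx
        linarith
    refine ⟨radiusLaw n, ∫⁻ x : E n, (closedBall (0 : E n) 2).indicator 1 x, tubeIntegral h 0,
      ?_, ?_, ?_, lintegral_indicator_closedBall_two_lt_top,
      (tubeIntegral_le h 0).trans_lt lintegral_indicator_closedBall_two_lt_top, ?_, ?_, ?_⟩
    · have : IsFiniteMeasure
          ((volume : Measure (E n)).withDensity fun x => ENNReal.ofReal (1 - ‖x‖)) :=
        isFiniteMeasure_withDensity
          ((lintegral_mono hle).trans_lt lintegral_indicator_closedBall_two_lt_top).ne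
      exact Measure.isFiniteMeasure_map _ _
    · rw [radiusLaw, Ne, Measure.map_eq_zero_iff (by fun_prop), withDensity_eq_zero_iff
        hG.aemeasurable]
      intro h0
      refine (measure_ball_pos (volume : Measure (E n)) 0 one_pos).ne'
        (measure_mono_null (fun x hx => ?_) h0)
      simpa using hx
    · rw [radiusLaw, ae_map_iff (by fun_prop) measurableSet_Ioi]
      refine (withDensity_absolutelyContinuous _ _).ae_le ?_
      have h0 : ∀ᵐ x : E n, x ≠ 0 := by simp [ae_iff]
      filter_upwards [h0] with x hx
      exact inv_pos.2 (norm_pos_iff.2 hx)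
    · rintro (hlt | h0)
      · exact tubeIntegral_zero_pos hlt
      · omega
    · rintro rfl _
      exact tubeIntegral_self_zero hm
    · intro z hz
      have hz0 : z ≠ 0 := hz.resolve_right hm.ne'
      refine ⟨fun ε hε => ?_, fun ε hε hε0 => ?_⟩
      · rw [averagedKernel_radiusLaw hn h hε hz0, mul_comm]
        gcongr
        exact tubeIntegral_le h _
      · simp only [averagedKernel_radiusLaw hn h (hε _) hz0, mul_comm (tubeIntegral h 0)]
        refine ENNReal.Tendsto.const_mul (tendsto_tubeIntegral h ?_) (Or.inr ?_)
        · simpa using hε0.div_const ‖z‖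
        · rw [edist_zero_right]
          exact ENNReal.rpow_ne_top_of_ne_zero (by simpa using hz0) (by simp)

end Kernel

/-! ### Ball energies of projected measures, integrated over planes. -/

section Planes

variable {n m : ℕ}

theorem isAddHaarMeasure_euclideanHausdorffMeasure_of_finrank_eq {W : Type*}
    [NormedAddCommGroup W] [InnerProductSpace ℝ W] [FiniteDimensional ℝ W] [MeasurableSpace W]
    [BorelSpace W] {k : ℕ} (hk : Module.finrank ℝ W = k) :
    (Measure.euclideanHausdorffMeasure k : Measure W).IsAddHaarMeasure := by
  subst hk
  infer_instance

theorem euclideanHausdorffMeasure_ball_of_finrank_eq {W : Type*}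
    [NormedAddCommGroup W] [InnerProductSpace ℝ W] [FiniteDimensional ℝ W] [MeasurableSpace W]
    [BorelSpace W] {k : ℕ} (hk : Module.finrank ℝ W = k) :
    (Measure.euclideanHausdorffMeasure k : Measure W) (ball 0 1)
      = volume (ball (0 : E k) 1) := by
  subst hk
  let e := (stdOrthonormalBasis ℝ W).repr
  rw [InnerProductSpace.euclideanHausdorffMeasure_eq_volume,
    ← e.measurePreserving.measure_preimage measurableSet_ball.nullMeasurableSet]
  congr 1
  ext x
  simp

instance (V : Gr n m) : (hausV V).IsAddHaarMeasure :=
  isAddHaarMeasure_euclideanHausdorffMeasure_of_finrank_eq V.2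

/-- The volume of the unit ball of `ℝᵐ`. -/
noncomputable def ballVolume (m : ℕ) : ℝ≥0∞ := volume (ball (0 : E m) 1)

theorem ballVolume_ne_zero (m : ℕ) : ballVolume m ≠ 0 := (measure_ball_pos _ _ one_pos).ne'

theorem ballVolume_ne_top (m : ℕ) : ballVolume m ≠ ∞ := measure_ball_lt_top.ne

theorem hausV_closedBall (V : Gr n m) (v : V.1) {δ : ℝ} (hδ : 0 ≤ δ) :
    hausV V (closedBall v δ) = ENNReal.ofReal (δ ^ m) * ballVolume m := by
  rw [Measure.addHaar_closedBall _ v hδ, V.2, hausV,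
    euclideanHausdorffMeasure_ball_of_finrank_eq V.2, ballVolume]

instance (V : Gr n m) (μ : Measure (E n)) [IsFiniteMeasure μ] :
    IsFiniteMeasure (projMeasure V μ) := by
  unfold projMeasure; infer_instance

theorem measurable_proj (V : Gr n m) : Measurable (proj V) := (proj V).continuous.measurable

theorem projMeasure_add (V : Gr n m) (μ ν : Measure (E n)) :
    projMeasure V (μ + ν) = projMeasure V μ + projMeasure V ν :=
  Measure.map_add _ _ (measurable_proj V)

theorem ballEnergy_projMeasure (V : Gr n m) (μ ν : Measure (E n)) [IsFiniteMeasure μ]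
    [IsFiniteMeasure ν] {δ : ℝ} (hδ : 0 ≤ δ) :
    ballEnergy (hausV V) δ (projMeasure V μ) (projMeasure V ν)
      = ν.prod μ {p | ‖proj V (p.2 - p.1)‖ ≤ δ} / (ENNReal.ofReal (δ ^ m) * ballVolume m) := by
  have hm := measurable_measure_closedBall (projMeasure V μ) δ
  have hS : MeasurableSet {p : E n × E n | ‖proj V (p.2 - p.1)‖ ≤ δ} :=
    (isClosed_le (by fun_prop) continuous_const).measurableSet
  simp only [ballEnergy, hausV_closedBall V _ hδ, div_eq_mul_inv]
  rw [lintegral_mul_const _ hm, Measure.prod_apply hS]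
  congr 1
  refine (lintegral_map hm (measurable_proj V)).trans ?_
  refine lintegral_congr fun y => ?_
  rw [projMeasure, Measure.map_apply (measurable_proj V) measurableSet_closedBall]
  congr 1
  ext x
  simp [dist_eq_norm]

theorem measurableSet_norm_proj_sub_le (δ : ℝ) :
    MeasurableSet {q : Gr n m × (E n × E n) | ‖proj q.1 (q.2.2 - q.2.1)‖ ≤ δ} :=
  (isClosed_le (continuous_norm_proj.comp
    (by fun_prop : Continuous fun q : Gr n m × (E n × E n) => (q.1, q.2.2 - q.2.1)))
    continuous_const).measurableSet

theorem measurable_ballEnergy_projMeasure (μ ν : Measure (E n)) [IsFiniteMeasure μ]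
    [IsFiniteMeasure ν] {δ : ℝ} (hδ : 0 ≤ δ) :
    Measurable fun V : Gr n m => ballEnergy (hausV V) δ (projMeasure V μ) (projMeasure V ν) := by
  simp only [ballEnergy_projMeasure _ μ ν hδ]
  exact (measurable_measure_prodMk_left (measurableSet_norm_proj_sub_le δ)).div_const _

theorem lintegral_ballEnergy_projMeasure (h : m ≤ n) (μ ν : Measure (E n)) [IsFiniteMeasure μ]
    [IsFiniteMeasure ν] {δ : ℝ} (hδ : 0 ≤ δ) :
    ∫⁻ V, ballEnergy (hausV V) δ (projMeasure V μ) (projMeasure V ν) ∂grMeasure h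
      = (∫⁻ p, smallProj h δ (p.2 - p.1) ∂ν.prod μ)
        / (ENNReal.ofReal (δ ^ m) * ballVolume m) := by
  have hS := measurableSet_norm_proj_sub_le (n := n) (m := m) δ
  have hm : Measurable fun V : Gr n m => ν.prod μ {p | ‖proj V (p.2 - p.1)‖ ≤ δ} :=
    measurable_measure_prodMk_left hS
  simp only [ballEnergy_projMeasure _ μ ν hδ, div_eq_mul_inv]
  rw [lintegral_mul_const _ hm]
  congr 1
  exact (Measure.prod_apply hS).symm.trans (Measure.prod_apply_symm hS)

theorem measurable_smallProj (h : m ≤ n) :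
    Measurable fun q : ℝ × E n => smallProj h q.1 q.2 := by
  have hS : MeasurableSet {q : (ℝ × E n) × Gr n m | ‖proj q.2 q.1.2‖ ≤ q.1.1} :=
    (isClosed_le (continuous_norm_proj.comp
      (by fun_prop : Continuous fun q : (ℝ × E n) × Gr n m => (q.2, q.1.2)))
      (by fun_prop)).measurableSet
  exact measurable_measure_prodMk_left hS

/-- The integral over all planes of the ball energy at scale `δ` of the two image measures. -/
noncomputable def grBallEnergy (h : m ≤ n) (μ ν : Measure (E n)) (δ : ℝ) : ℝ≥0∞ :=
  ∫⁻ V, ballEnergy (hausV V) δ (projMeasure V μ) (projMeasure V ν) ∂grMeasure h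

theorem measurable_averagedKernel_integrand (h : m ≤ n) (ε : ℝ) :
    Measurable fun q : ℝ × E n =>
      smallProj h (ε * q.1) q.2 / ENNReal.ofReal ((ε * q.1) ^ m) :=
  ((measurable_smallProj h).comp (by fun_prop : Measurable fun q : ℝ × E n => (ε * q.1, q.2))).div
    (by fun_prop)

theorem measurable_averagedKernel (h : m ≤ n) (ρ : Measure ℝ) [IsFiniteMeasure ρ] (ε : ℝ) :
    Measurable (averagedKernel h ρ ε) :=
  ((measurable_averagedKernel_integrand h ε).comp measurable_swap).lintegral_prod_right'

theorem grBallEnergy_ae_eq (h : m ≤ n) (μ ν : Measure (E n)) [IsFiniteMeasure μ]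
    [IsFiniteMeasure ν] {ρ : Measure ℝ} (hρ : ∀ᵐ s ∂ρ, 0 < s) {ε : ℝ} (hε : 0 < ε) :
    (fun s => grBallEnergy h μ ν (ε * s)) =ᵐ[ρ] fun s =>
      (∫⁻ p, smallProj h (ε * s) (p.2 - p.1) / ENNReal.ofReal ((ε * s) ^ m) ∂ν.prod μ)
        / ballVolume m := by
  filter_upwards [hρ] with s hs
  have hεs : 0 < ε * s := mul_pos hε hs
  rw [grBallEnergy, lintegral_ballEnergy_projMeasure h μ ν hεs.le]
  simp only [div_eq_mul_inv]
  rw [lintegral_mul_const' _ _ (by simpa using pow_pos hεs m), mul_assoc,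
    ENNReal.mul_inv (Or.inr (ballVolume_ne_top m)) (Or.inl ENNReal.ofReal_ne_top)]

theorem measurable_averagedKernel_integrand_sub (h : m ≤ n) (ε : ℝ) :
    Measurable fun q : ℝ × (E n × E n) =>
      smallProj h (ε * q.1) (q.2.2 - q.2.1) / ENNReal.ofReal ((ε * q.1) ^ m) := by
  have hf : Measurable fun q : ℝ × (E n × E n) => (ε * q.1, q.2.2 - q.2.1) := by fun_prop
  exact ((measurable_smallProj h).comp hf).div (by fun_prop)

theorem aemeasurable_grBallEnergy (h : m ≤ n) (μ ν : Measure (E n)) [IsFiniteMeasure μ]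
    [IsFiniteMeasure ν] {ρ : Measure ℝ} (hρ : ∀ᵐ s ∂ρ, 0 < s) {ε : ℝ} (hε : 0 < ε) :
    AEMeasurable (fun s => grBallEnergy h μ ν (ε * s)) ρ :=
  ⟨_, (measurable_averagedKernel_integrand_sub h ε).lintegral_prod_right'.div_const _,
    grBallEnergy_ae_eq h μ ν hρ hε⟩

theorem lintegral_grBallEnergy (h : m ≤ n) (μ ν : Measure (E n)) [IsFiniteMeasure μ]
    [IsFiniteMeasure ν] {ρ : Measure ℝ} [IsFiniteMeasure ρ] (hρ : ∀ᵐ s ∂ρ, 0 < s) {ε : ℝ}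
    (hε : 0 < ε) :
    ∫⁻ s, grBallEnergy h μ ν (ε * s) ∂ρ
      = (∫⁻ p, averagedKernel h ρ ε (p.2 - p.1) ∂ν.prod μ) / ballVolume m := by
  have hm := measurable_averagedKernel_integrand_sub h ε (n := n) (m := m)
  rw [lintegral_congr_ae (grBallEnergy_ae_eq h μ ν hρ hε)]
  simp only [div_eq_mul_inv (b := ballVolume m)]
  rw [lintegral_mul_const _ hm.lintegral_prod_right', lintegral_lintegral_swap hm.aemeasurable]
  rfl

theorem mutualEnergy_eq_lintegral_prod (s : ℝ) (μ ν : Measure (E n)) [IsFiniteMeasure μ]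
    [IsFiniteMeasure ν] :
    mutualEnergy s μ ν = ∫⁻ p, edist (p.2 - p.1) 0 ^ (-s) ∂ν.prod μ := by
  have hm : Measurable fun p : E n × E n => edist (p.2 - p.1) 0 ^ (-s) :=
    (by fun_prop : Measurable fun p : E n × E n => edist (p.2 - p.1) 0).pow_const _
  rw [lintegral_prod _ hm.aemeasurable]
  simp only [mutualEnergy, edist_eq_enorm_sub, sub_zero]

theorem mutualEnergy_comm (s : ℝ) (μ ν : Measure (E n)) [IsFiniteMeasure μ] [IsFiniteMeasure ν] :
    mutualEnergy s μ ν = mutualEnergy s ν μ := by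
  have hm : Measurable fun p : E n × E n => edist p.2 p.1 ^ (-s) :=
    (by fun_prop : Measurable fun p : E n × E n => edist p.2 p.1).pow_const _
  rw [mutualEnergy, lintegral_lintegral_swap hm.aemeasurable, mutualEnergy]
  simp only [edist_comm]

theorem energy_add (s : ℝ) (μ ν : Measure (E n)) [IsFiniteMeasure μ] [IsFiniteMeasure ν] :
    energy s (μ + ν) = energy s μ + energy s ν + 2 * mutualEnergy s μ ν := by
  have hm : Measurable fun p : E n × E n => edist p.2 p.1 ^ (-s) :=
    (by fun_prop : Measurable fun p : E n × E n => edist p.2 p.1).pow_const _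
  have hμ : Measurable fun y : E n => ∫⁻ x, edist x y ^ (-s) ∂μ := hm.lintegral_prod_right'
  simp only [energy, mutualEnergy, lintegral_add_measure]
  rw [lintegral_add_left hμ, lintegral_add_left hμ]
  have hc := mutualEnergy_comm s μ ν
  simp only [mutualEnergy] at hc
  rw [← hc]
  ring

/-- An atom would make the energy infinite, since the kernel is `∞` on the diagonal for `s > 0`.
Thus `μ` has no atoms and the diagonal is null for its product with any finite `ν`. -/
theorem ae_sub_ne_zero_of_energy_lt_top {s : ℝ} (hs : 0 < s) {μ : Measure (E n)}
    [IsFiniteMeasure μ] (hμ : energy s μ < ∞) (ν : Measure (E n)) [IsFiniteMeasure ν] :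
    ∀ᵐ p ∂ν.prod μ, p.2 - p.1 ≠ 0 := by
  have hatom : ∀ a, μ {a} = 0 := by
    intro a
    by_contra ha
    refine hμ.ne (top_le_iff.1 ?_)
    calc ∞ = ∫⁻ y in {a}, ∫⁻ x in {a}, edist x y ^ (-s) ∂μ ∂μ := by
          simp [ENNReal.zero_rpow_of_neg (neg_lt_zero.2 hs), ha]
      _ ≤ energy s μ := (setLIntegral_le_lintegral _ _).trans
          (lintegral_mono fun y => setLIntegral_le_lintegral _ _)
  have hS : MeasurableSet {p : E n × E n | p.2 - p.1 ≠ 0} :=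
    (isOpen_ne_fun (by fun_prop) continuous_const).measurableSet
  rw [Measure.ae_prod_iff_ae_ae hS]
  refine Eventually.of_forall fun y => ?_
  rw [ae_iff]
  simpa [sub_eq_zero] using hatom y

end Planes

/-! ### Projected energy as a multiple of the Riesz energy. -/

section Energy

variable {n m : ℕ}

/-- The integral over all planes of the squared `L²` norms of the projected densities. -/
noncomputable def grEnergy (h : m ≤ n) (μ : Measure (E n)) : ℝ≥0∞ :=
  ∫⁻ V, densityEnergy (hausV V) (projMeasure V μ) ∂grMeasure h

/-- A pointwise limit of ball energies, each measurable in `V` by Fubini; no joint choice of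
densities in `V` and `v` is needed. -/
theorem measurable_densityEnergy_projMeasure (μ : Measure (E n)) [IsFiniteMeasure μ] :
    Measurable fun V : Gr n m => densityEnergy (hausV V) (projMeasure V μ) := by
  refine measurable_of_tendsto_metrizable
    (f := fun (k : ℕ) (V : Gr n m) =>
      ballEnergy (hausV V) (1 / ((k : ℝ) + 1)) (projMeasure V μ) (projMeasure V μ))
    (fun k => measurable_ballEnergy_projMeasure μ μ (by positivity)) ?_
  rw [tendsto_pi_nhds]
  exact fun V => tendsto_ballEnergy _ _ (fun k => by positivity)
    tendsto_one_div_add_atTop_nhds_zero_nat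

theorem two_mul_grBallEnergy_le (h : m ≤ n) (μ ν : Measure (E n)) [IsFiniteMeasure μ]
    [IsFiniteMeasure ν] {δ : ℝ} (hδ : 0 < δ) :
    2 * grBallEnergy h μ ν δ ≤ grEnergy h μ + grEnergy h ν := by
  rw [grBallEnergy, grEnergy, grEnergy,
    ← lintegral_const_mul _ (measurable_ballEnergy_projMeasure μ ν hδ.le),
    ← lintegral_add_left (measurable_densityEnergy_projMeasure μ)]
  exact lintegral_mono fun V => two_mul_ballEnergy_le _ _ _ δ

theorem grBallEnergy_self_le (h : m ≤ n) (μ : Measure (E n)) [IsFiniteMeasure μ]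
    (δ : ℝ) : grBallEnergy h μ μ δ ≤ grEnergy h μ :=
  lintegral_mono fun _ => ballEnergy_self_le _ _ δ

theorem grEnergy_le_liminf (h : m ≤ n) (μ : Measure (E n)) [IsFiniteMeasure μ] {δ : ℕ → ℝ}
    (hδ : ∀ k, 0 < δ k) (hδ0 : Tendsto δ atTop (𝓝 0)) :
    grEnergy h μ ≤ liminf (fun k => grBallEnergy h μ μ (δ k)) atTop :=
  (lintegral_mono fun _ => densityEnergy_le_liminf_ballEnergy _ _ hδ hδ0).trans
    (lintegral_liminf_le fun k => measurable_ballEnergy_projMeasure μ μ (hδ k).le)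

/-- The projected `L²` energy is a constant multiple of the Riesz energy; the mutual energy is
controlled by the projected energies. -/
theorem exists_grEnergy_eq (h : m ≤ n) :
    ∃ c : ℝ≥0∞, c < ∞ ∧ ((m < n ∨ m = 0) → 0 < c) ∧ (m = n → 0 < m → c = 0) ∧
      (∀ μ : Measure (E n), IsFiniteMeasure μ → energy m μ < ∞ →
        grEnergy h μ = c * energy m μ) ∧
      ∀ μ ν : Measure (E n), IsFiniteMeasure μ → IsFiniteMeasure ν → energy m μ < ∞ →
        2 * (c * mutualEnergy m μ ν) ≤ grEnergy h μ + grEnergy h ν := by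
  obtain ⟨ρ, C, c, hfin, hρ0, hρ, hC, hc, hcpos, hczero, hK⟩ := exists_averagedKernel h
  set κ := ballVolume m with hκ
  have hκ0 : κ ≠ 0 := ballVolume_ne_zero m
  have hκt : κ ≠ ∞ := ballVolume_ne_top m
  set R := ρ Set.univ with hR
  have hR0 : R ≠ 0 := by simpa [hR] using hρ0
  have hRt : R ≠ ∞ := measure_ne_top _ _
  set ε : ℕ → ℝ := fun k => 1 / ((k : ℝ) + 1) with hεdef
  have hε : ∀ k, 0 < ε k := fun k => by positivity
  have hε0 : Tendsto ε atTop (𝓝 0) := tendsto_one_div_add_atTop_nhds_zero_nat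
  have hae : ∀ μ ν : Measure (E n), IsFiniteMeasure μ → IsFiniteMeasure ν → energy m μ < ∞ →
      ∀ᵐ p ∂ν.prod μ, p.2 - p.1 ≠ 0 ∨ m = 0 := by
    intro μ ν _ _ hμ
    rcases Nat.eq_zero_or_pos m with h0 | hm
    · exact Eventually.of_forall fun p => Or.inr h0
    · filter_upwards [ae_sub_ne_zero_of_energy_lt_top (Nat.cast_pos.2 hm) hμ ν] with p hp
      exact Or.inl hp
  have hmK : ∀ k, Measurable fun p : E n × E n => averagedKernel h ρ (ε k) (p.2 - p.1) := fun k =>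
    (measurable_averagedKernel h ρ (ε k)).comp (by fun_prop)
  have hmE : Measurable fun p : E n × E n => edist (p.2 - p.1) 0 ^ (-(m : ℝ)) :=
    (by fun_prop : Measurable fun p : E n × E n => edist (p.2 - p.1) 0).pow_const _
  -- The final constant divides the kernel's limit constant by the unit-ball volume `κ` and by the
  -- total mass `R` of the radius law.
  have hcR : ∀ I : ℝ≥0∞, R * (c / (κ * R) * I) = c * I / κ := by
    intro I
    rw [div_eq_mul_inv, ENNReal.mul_inv (Or.inl hκ0) (Or.inl hκt), div_eq_mul_inv]
    calc R * (c * (κ⁻¹ * R⁻¹) * I) = (R * R⁻¹) * (c * I * κ⁻¹) := by ring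
      _ = c * I * κ⁻¹ := by rw [ENNReal.mul_inv_cancel hR0 hRt, one_mul]
  refine ⟨c / (κ * R), ENNReal.div_lt_top hc.ne (mul_ne_zero hκ0 hR0), fun hmn => ?_, ?_, ?_, ?_⟩
  · exact ENNReal.div_pos (hcpos hmn).ne' (ENNReal.mul_ne_top hκt hRt)
  · intro h1 h2
    rw [hczero h1 h2, ENNReal.zero_div]
  · intro μ _ hμ
    have hμ' := hμ
    rw [energy, mutualEnergy_eq_lintegral_prod] at hμ'
    have hlim : Tendsto (fun k => ∫⁻ s, grBallEnergy h μ μ (ε k * s) ∂ρ) atTop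
        (𝓝 (c * energy m μ / κ)) := by
      simp only [lintegral_grBallEnergy h μ μ hρ (hε _)]
      refine ENNReal.Tendsto.div_const ?_ (Or.inr hκ0)
      rw [energy, mutualEnergy_eq_lintegral_prod, ← lintegral_const_mul _ hmE]
      refine tendsto_lintegral_of_dominated_convergence
        (fun p => C * edist (p.2 - p.1) 0 ^ (-(m : ℝ))) hmK (fun k => ?_) ?_ ?_
      · filter_upwards [hae μ μ ‹_› ‹_› hμ] with p hp
        exact (hK _ hp).1 _ (hε k)
      · rw [lintegral_const_mul _ hmE]
        exact (ENNReal.mul_lt_top hC hμ').ne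
      · filter_upwards [hae μ μ ‹_› ‹_› hμ] with p hp
        exact (hK _ hp).2 ε hε hε0
    have hRJ : R * grEnergy h μ = c * energy m μ / κ := by
      have hconst : R * grEnergy h μ = ∫⁻ _, grEnergy h μ ∂ρ := by
        rw [lintegral_const, mul_comm]
      -- Upper bound on the projected energy: Fatou in the averaging variable `s`. Lower bound: ball
      -- energies never exceed the projected energy at any scale.
      refine le_antisymm ?_ (le_of_tendsto' hlim fun k => ?_)
      · rw [← hlim.liminf_eq, hconst]
        refine le_trans (lintegral_mono_ae ?_)
          (lintegral_liminf_le' fun k => aemeasurable_grBallEnergy h μ μ hρ (hε k))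
        filter_upwards [hρ] with s hs
        exact grEnergy_le_liminf h μ (fun k => mul_pos (hε k) hs)
          (by simpa using hε0.mul_const s)
      · rw [hconst]
        exact lintegral_mono fun s => grBallEnergy_self_le h μ (ε k * s)
    rw [← hcR] at hRJ
    exact (ENNReal.mul_right_inj hR0 hRt).1 hRJ
  · intro μ ν _ _ hμ
    have hbound : ∀ k, 2 * ((∫⁻ p, averagedKernel h ρ (ε k) (p.2 - p.1) ∂ν.prod μ) / κ)
        ≤ R * (grEnergy h μ + grEnergy h ν) := by
      intro k
      rw [← lintegral_grBallEnergy h μ ν hρ (hε k),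
        ← lintegral_const_mul'' _ (aemeasurable_grBallEnergy h μ ν hρ (hε k)), mul_comm,
        ← lintegral_const]
      refine lintegral_mono_ae ?_
      filter_upwards [hρ] with s hs
      exact two_mul_grBallEnergy_le h μ ν (mul_pos (hε k) hs)
    -- Finiteness of the mutual energy is not yet known, so there is no integrable majorant; Fatou
    -- replaces dominated convergence.
    have hfatou : c * mutualEnergy m μ ν
        ≤ liminf (fun k => ∫⁻ p, averagedKernel h ρ (ε k) (p.2 - p.1) ∂ν.prod μ) atTop := by
      rw [mutualEnergy_eq_lintegral_prod, ← lintegral_const_mul _ hmE]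
      refine le_trans (lintegral_mono_ae ?_) (lintegral_liminf_le hmK)
      filter_upwards [hae μ ν ‹_› ‹_› hμ] with p hp
      exact ((hK _ hp).2 ε hε hε0).liminf_eq.ge
    have hle : c * mutualEnergy m μ ν ≤ R * (grEnergy h μ + grEnergy h ν) / 2 * κ := by
      refine hfatou.trans (liminf_le_of_le (by isBoundedDefault) fun b hb => ?_)
      obtain ⟨k, hk⟩ := hb.exists
      refine hk.trans ?_
      rw [← ENNReal.div_le_iff hκ0 hκt, ENNReal.le_div_iff_mul_le (by simp) (by simp), mul_comm]
      exact hbound k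
    rw [← ENNReal.div_le_iff hκ0 hκt, ← hcR, ENNReal.le_div_iff_mul_le (by simp) (by simp),
      mul_comm, mul_left_comm] at hle
    exact (ENNReal.mul_le_mul_iff_right hR0 hRt).1 hle

end Energy

/-! ### Polarization, positivity and supports. -/

section Main

variable {n m : ℕ}

/-- Distances are finite and the exponent is nonpositive, so the kernel vanishes nowhere. -/
theorem mutualEnergy_pos {s : ℝ} (hs : 0 ≤ s) {μ ν : Measure (E n)} [IsFiniteMeasure μ]
    [IsFiniteMeasure ν] (hμ : μ ≠ 0) (hν : ν ≠ 0) : 0 < mutualEnergy s μ ν := by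
  rw [pos_iff_ne_zero, mutualEnergy_eq_lintegral_prod]
  intro h
  rw [lintegral_eq_zero_iff
    ((by fun_prop : Measurable fun p : E n × E n => edist (p.2 - p.1) 0).pow_const _)] at h
  have hfalse : ∀ᵐ p ∂ν.prod μ, False := by
    filter_upwards [h] with p hp
    rw [Pi.zero_apply, ENNReal.rpow_neg, ENNReal.inv_eq_zero] at hp
    exact ENNReal.rpow_ne_top_of_nonneg hs (edist_ne_top _ _) hp
  rw [eventually_false_iff_eq_bot, ae_eq_bot] at hfalse
  have h0 : (ν.prod μ) (Set.univ ×ˢ Set.univ) = 0 := by rw [hfalse]; rfl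
  rw [Measure.prod_prod, mul_eq_zero, Measure.measure_univ_eq_zero,
    Measure.measure_univ_eq_zero] at h0
  exact h0.elim hν hμ

/-- The image measure gives no mass to the complement of the projected support, which is compact and
hence measurable. -/
theorem projDensity_eq_zero_of_notMem (V : Gr n m) {μ : Measure (E n)} [IsFiniteMeasure μ]
    (hμ : IsCompact μ.support) :
    ∀ᵐ v ∂hausV V, v ∉ proj V '' μ.support → projDensity V μ v = 0 := by
  set K := proj V '' μ.support with hK
  have hKm : MeasurableSet K := (hμ.image (proj V).continuous).isClosed.measurableSet
  have hKc : projMeasure V μ Kᶜ = 0 := by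
    rw [projMeasure, Measure.map_apply (measurable_proj V) hKm.compl]
    exact measure_mono_null (fun x hx hxs => hx ⟨x, hxs, rfl⟩)
      (Measure.measure_compl_support (μ := μ))
  have hint : ∫⁻ v in Kᶜ, projDensity V μ v ∂hausV V = 0 :=
    le_antisymm ((Measure.setLIntegral_rnDeriv_le _).trans hKc.le) zero_le
  exact (ae_restrict_iff' hKm.compl).1
    ((lintegral_eq_zero_iff (Measure.measurable_rnDeriv _ _)).1 hint)

theorem lintegral_projDensity_mul_eq_zero (V : Gr n m) {μ ν : Measure (E n)} [IsFiniteMeasure μ]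
    [IsFiniteMeasure ν] (hμ : IsCompact μ.support) (hν : IsCompact ν.support)
    (h0 : hausV V (proj V '' μ.support ∩ proj V '' ν.support) = 0) :
    ∫⁻ v, projDensity V μ v * projDensity V ν v ∂hausV V = 0 := by
  refine (lintegral_congr_ae ?_).trans lintegral_zero
  filter_upwards [projDensity_eq_zero_of_notMem V hμ, projDensity_eq_zero_of_notMem V hν,
    measure_eq_zero_iff_ae_notMem.1 h0] with v h1 h2 h3
  by_cases hv : v ∈ proj V '' μ.support
  · rw [h2 fun hv' => h3 ⟨hv, hv'⟩, mul_zero]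
  · rw [h1 hv, zero_mul]

/-- If it were zero, some plane would carry the zero image measure, although projecting preserves
total mass. -/
theorem grEnergy_ne_zero (h : m ≤ n) {μ : Measure (E n)} [IsFiniteMeasure μ] (hμ : μ ≠ 0) :
    grEnergy h μ ≠ 0 := by
  intro h0
  rw [grEnergy, lintegral_eq_zero_iff (measurable_densityEnergy_projMeasure μ)] at h0
  obtain ⟨V, hV⟩ := h0.exists
  have hz := eq_zero_of_densityEnergy_eq_zero hV
  rw [projMeasure, Measure.map_eq_zero_iff (measurable_proj V).aemeasurable] at hz
  exact hμ hz

theorem ae_projMeasure_absolutelyContinuous (h : m ≤ n) {μ : Measure (E n)} [IsFiniteMeasure μ]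
    (hμ : grEnergy h μ ≠ ∞) :
    ∀ᵐ V ∂grMeasure h, projMeasure V μ ≪ hausV V := by
  filter_upwards [ae_lt_top (measurable_densityEnergy_projMeasure μ) hμ] with V hV
  exact absolutelyContinuous_of_densityEnergy_ne_top hV.ne

theorem ae_densityEnergy_projMeasure_add (h : m ≤ n) {μ ν : Measure (E n)} [IsFiniteMeasure μ]
    [IsFiniteMeasure ν] (hμ : grEnergy h μ ≠ ∞) (hν : grEnergy h ν ≠ ∞) :
    ∀ᵐ V ∂grMeasure h, densityEnergy (hausV V) (projMeasure V (μ + ν))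
      = densityEnergy (hausV V) (projMeasure V μ) + densityEnergy (hausV V) (projMeasure V ν)
        + 2 * ∫⁻ v, projDensity V μ v * projDensity V ν v ∂hausV V := by
  filter_upwards [ae_projMeasure_absolutelyContinuous h hμ,
    ae_projMeasure_absolutelyContinuous h hν] with V h1 h2
  rw [projMeasure_add]
  exact densityEnergy_add h1 h2

/-- By polarization the function agrees a.e. with half the energy of `μ + ν` minus those of `μ` and
`ν`; subtraction is legitimate where the latter two are finite. -/
theorem aemeasurable_lintegral_projDensity_mul (h : m ≤ n) {μ ν : Measure (E n)}
    [IsFiniteMeasure μ] [IsFiniteMeasure ν] (hμ : grEnergy h μ ≠ ∞) (hν : grEnergy h ν ≠ ∞) :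
    AEMeasurable (fun V : Gr n m => ∫⁻ v, projDensity V μ v * projDensity V ν v ∂hausV V)
      (grMeasure h) := by
  have hm1 := measurable_densityEnergy_projMeasure (m := m) μ
  have hm2 := measurable_densityEnergy_projMeasure (m := m) ν
  have hm3 := measurable_densityEnergy_projMeasure (m := m) (μ + ν)
  refine ⟨_, (hm3.sub (hm1.add hm2)).div_const 2, ?_⟩
  filter_upwards [ae_densityEnergy_projMeasure_add h hμ hν, ae_lt_top hm1 hμ,
    ae_lt_top hm2 hν] with V h1 h2 h3
  rw [Pi.sub_apply, h1, Pi.add_apply,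
    ENNReal.add_sub_cancel_left (ENNReal.add_ne_top.2 ⟨h2.ne, h3.ne⟩),
    mul_div_assoc, ENNReal.mul_div_cancel two_ne_zero ENNReal.ofNat_ne_top]

theorem grEnergy_add (h : m ≤ n) {μ ν : Measure (E n)} [IsFiniteMeasure μ]
    [IsFiniteMeasure ν] (hμ : grEnergy h μ ≠ ∞) (hν : grEnergy h ν ≠ ∞) :
    grEnergy h (μ + ν) = grEnergy h μ + grEnergy h ν
      + 2 * ∫⁻ V, ∫⁻ v, projDensity V μ v * projDensity V ν v ∂hausV V ∂grMeasure h := by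
  have hm1 := measurable_densityEnergy_projMeasure (m := m) μ
  have hm2 := measurable_densityEnergy_projMeasure (m := m) ν
  have hm12 : Measurable fun V : Gr n m => densityEnergy (hausV V) (projMeasure V μ)
      + densityEnergy (hausV V) (projMeasure V ν) := hm1.add hm2
  rw [grEnergy, lintegral_congr_ae (ae_densityEnergy_projMeasure_add h hμ hν),
    lintegral_add_left hm12, lintegral_add_left hm1,
    lintegral_const_mul'' _ (aemeasurable_lintegral_projDensity_mul h hμ hν)]
  rfl

theorem MemM.isFiniteMeasure {μ : Measure (E n)} (hμ : MemM Set.univ μ) : IsFiniteMeasure μ :=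
  ⟨hμ.2.1⟩

theorem MemM.ne_zero {μ : Measure (E n)} (hμ : MemM Set.univ μ) : μ ≠ 0 := by
  rintro rfl
  exact hμ.1.ne' rfl

end Main

end IntProj

theorem mainTheorem5 (n m : ℕ) (hmn : m ≤ n) :
    ∃ c : ℝ≥0∞, 0 < c ∧ c < ∞ ∧
      ∀ μ ν : Measure (IntProj.E n),
        IntProj.MemM Set.univ μ → IntProj.MemM Set.univ ν →
        IntProj.energy (m : ℝ) μ < ∞ → IntProj.energy (m : ℝ) ν < ∞ →
        -- for almost every `V` both image measures are functions on `V`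
        (∀ᵐ V ∂(IntProj.grMeasure hmn),
          IntProj.projMeasure V μ ≪ IntProj.hausV V ∧
          IntProj.projMeasure V ν ≪ IntProj.hausV V) ∧
        -- the double integral is well defined, finite and positive
        AEMeasurable
          (fun V : IntProj.Gr n m =>
            ∫⁻ v, IntProj.projDensity V μ v * IntProj.projDensity V ν v ∂(IntProj.hausV V))
          (IntProj.grMeasure hmn) ∧
        0 < ∫⁻ V, ∫⁻ v, IntProj.projDensity V μ v * IntProj.projDensity V ν v
            ∂(IntProj.hausV V) ∂(IntProj.grMeasure hmn) ∧
        ∫⁻ V, ∫⁻ v, IntProj.projDensity V μ v * IntProj.projDensity V ν v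
            ∂(IntProj.hausV V) ∂(IntProj.grMeasure hmn) < ∞ ∧
        -- it is a constant multiple of the mutual energy
        ∫⁻ V, ∫⁻ v, IntProj.projDensity V μ v * IntProj.projDensity V ν v
            ∂(IntProj.hausV V) ∂(IntProj.grMeasure hmn)
          = c * IntProj.mutualEnergy (m : ℝ) μ ν ∧
        -- positively many projections of the supports meet in positive measure
        0 < IntProj.grMeasure hmn
          {V | 0 < IntProj.hausV V
            (IntProj.proj V '' μ.support ∩ IntProj.proj V '' ν.support)} := by
  open IntProj in
  obtain ⟨c, hct, hcpos, hczero, hself, hmutual⟩ := exists_grEnergy_eq hmn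
  by_cases hm : m < n ∨ m = 0
  swap
  -- in the top dimension `m = n > 0` no nonzero measure has finite energy
  · push Not at hm
    refine ⟨1, one_pos, ENNReal.one_lt_top, fun μ ν hμ _ hEμ _ => ?_⟩
    have := hμ.isFiniteMeasure
    have hc : c = 0 := hczero (le_antisymm hmn hm.1) (Nat.pos_of_ne_zero hm.2)
    refine absurd ?_ (grEnergy_ne_zero hmn hμ.ne_zero)
    rw [hself μ this hEμ, hc, zero_mul]
  refine ⟨c, hcpos hm, hct, fun μ ν hμ hν hEμ hEν => ?_⟩
  have hfμ := hμ.isFiniteMeasure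
  have hfν := hν.isFiniteMeasure
  have hgμ : grEnergy hmn μ ≠ ∞ := by
    rw [hself μ hfμ hEμ]; exact ENNReal.mul_ne_top hct.ne hEμ.ne
  have hgν : grEnergy hmn ν ≠ ∞ := by
    rw [hself ν hfν hEν]; exact ENNReal.mul_ne_top hct.ne hEν.ne
  -- This makes `μ + ν` a measure of finite energy, so that the quadratic identity applies to it as
  -- well.
  have hI : mutualEnergy m μ ν ≠ ∞ := by
    intro htop
    have hle := hmutual μ ν hfμ hfν hEμ
    rw [htop, ENNReal.mul_top (hcpos hm).ne', ENNReal.mul_top two_ne_zero, top_le_iff] at hle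
    exact ENNReal.add_ne_top.2 ⟨hgμ, hgν⟩ hle
  have hsum : energy m (μ + ν) < ∞ := by
    rw [energy_add]
    exact (ENNReal.add_ne_top.2 ⟨ENNReal.add_ne_top.2 ⟨hEμ.ne, hEν.ne⟩,
      ENNReal.mul_ne_top ENNReal.ofNat_ne_top hI⟩).lt_top
  have heq : ∫⁻ V, ∫⁻ v, projDensity V μ v * projDensity V ν v ∂hausV V ∂grMeasure hmn
      = c * mutualEnergy m μ ν := by
    have h1 := grEnergy_add hmn hgμ hgν
    rw [hself (μ + ν) inferInstance hsum, energy_add, mul_add, mul_add, ← hself μ hfμ hEμ,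
      ← hself ν hfν hEν, ENNReal.add_right_inj (ENNReal.add_ne_top.2 ⟨hgμ, hgν⟩),
      mul_left_comm] at h1
    exact ((ENNReal.mul_right_inj two_ne_zero ENNReal.ofNat_ne_top).1 h1).symm
  have hpos : 0 < ∫⁻ V, ∫⁻ v, projDensity V μ v * projDensity V ν v ∂hausV V ∂grMeasure hmn := by
    rw [heq]
    exact ENNReal.mul_pos (hcpos hm).ne'
      (mutualEnergy_pos (Nat.cast_nonneg m) hμ.ne_zero hν.ne_zero).ne'
  refine ⟨(ae_projMeasure_absolutelyContinuous hmn hgμ).and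
    (ae_projMeasure_absolutelyContinuous hmn hgν),
    aemeasurable_lintegral_projDensity_mul hmn hgμ hgν, hpos, ?_, heq, ?_⟩
  · rw [heq]
    exact (ENNReal.mul_ne_top hct.ne hI).lt_top
  · rw [pos_iff_ne_zero]
    intro h0
    -- If the projected supports met in a null set for almost every plane, the inner integrals would
    -- vanish almost everywhere, against positivity.
    refine hpos.ne' ((lintegral_congr_ae ?_).trans lintegral_zero)
    filter_upwards [measure_eq_zero_iff_ae_notMem.1 h0] with V hV
    exact lintegral_projDensity_mul_eq_zero V hμ.2.2.1 hν.2.2.1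
      (nonpos_iff_eq_zero.1 (not_lt.1 hV))
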